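/- Let $2<\beta<3$, $w_0>0$ and $\lambda>0$ be constants. For integers $n,d\ge 1$, the standard geometric inhomogeneous random graph $G=\mathrm{GIRG}(n,\beta,w_0,d)$ is the following random graph on $n$ vertices. Each vertex $v$ independently receives a weight $w_v$ with the Pareto distribution $\Pr(w_v\le x)=1-(x/w_0)^{1-\beta}$ for $x\ge w_0$, and, independently, a position $\mathbf{x}_v$ that is uniformly distributed on the torus $\mathbb{T}^d=(\mathbb{R}/\mathbb{Z})^d$ with the distance $d(\mathbf{x},\mathbf{y})=\max_{1\le i\le d}|\mathbf{x}_i-\mathbf{y}_i|_C$, where $|\cdot|_C$ is the distance on the circle of circumference $1$. Two vertices $u\ne v$ are adjacent if and only if $$d(\mathbf{x}_u,\mathbf{x}_v)\le \frac12\left(\frac{\lambda w_uw_v}{n}\right)^{1/d}.$$ Let $K_k$ be the number of $k$-cliques of $G$ and let $\omega(G)$ be its clique number. **Theorem.** Let $d=d(n)=\omega(\log n)$, that is, $d(n)/\log n\to\infty$. Then $$\mathbb{E}[K_k]=n^{\frac k2(3-\beta)}\,\Theta(k)^{-k}\qquad\text{for all }3\le k\le n,$$ uniformly in $k$: there are constants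 $c_1,c_2>0$, depending only on $\beta,w_0,\lambda$, such that for all sufficiently large $n$ and all integers $k$ with $3\le k\le n$, $$n^{\frac k2(3-\beta)}(c_1k)^{-k}\le \mathbb{E}[K_k]\le n^{\frac k2(3-\beta)}(c_2k)^{-k}.$$ Moreover, $\omega(G)=\Theta(n^{(3-\beta)/2})$ asymptotically almost surely: there are constants $C_1,C_2>0$, depending only on $\beta,w_0,\lambda$, such that $$\Pr\left(C_1n^{(3-\beta)/2}\le\omega(G)\le C_2n^{(3-\beta)/2}\right)\longrightarrow 1\qquad(n\to\infty).$$ -/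

import Mathlib

open Filter Topology MeasureTheory ProbabilityTheory

noncomputable section

/-- Attributes of a vertex of a geometric inhomogeneous random graph: its weight, and its position on
the `d`-dimensional torus `(ℝ/ℤ)^d`. The distance that Mathlib puts on `Fin d → UnitAddCircle` is
`max_i |x_i - y_i|_C`, where `|·|_C` is the distance on the circle of circumference `1`. -/
abbrev GIRGVertex (d : ℕ) : Type := ℝ × (Fin d → UnitAddCircle)

/-- The law of one vertex: the weight has the Pareto distribution with density
`(β - 1) w₀^(β - 1) x^(-β)` on `[w₀, ∞)`, that is, `P(w ≤ x) = 1 - (x / w₀)^(1 - β)` for `x ≥ w₀`,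
and the position is independent of it and uniform on the torus. -/
def girgVertexLaw (β w₀ : ℝ) (d : ℕ) : Measure (GIRGVertex d) :=
  (paretoMeasure w₀ (β - 1)).prod volume

/-- The joint law of the `n` independent vertices. -/
def girgLaw (n : ℕ) (β w₀ : ℝ) (d : ℕ) : Measure (Fin n → GIRGVertex d) :=
  Measure.pi fun _ => girgVertexLaw β w₀ d

/-- The connection threshold `t_uv = (1/2) (lam * w_u * w_v / n)^(1/d)` of two vertices with weights
`a` and `b`. -/
def connectionThreshold (lam : ℝ) (n d : ℕ) (a b : ℝ) : ℝ :=
  1 / 2 * (lam * a * b / n) ^ (1 / (d : ℝ))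

/-- The standard GIRG as a function of the vertex attributes: distinct vertices are adjacent if and
only if their distance on the torus is at most their connection threshold. Under the probability
measure `girgLaw n β w₀ d` this is the random graph `GIRG(n, β, w₀, d)`. -/
def girgGraph (lam : ℝ) {n d : ℕ} (ω : Fin n → GIRGVertex d) : SimpleGraph (Fin n) where
  Adj u v := u ≠ v ∧ dist (ω u).2 (ω v).2 ≤ connectionThreshold lam n d (ω u).1 (ω v).1
  symm := ⟨fun u v h => ⟨h.1.symm, by
    have h2 := h.2
    rw [dist_comm, connectionThreshold, mul_right_comm lam] at h2
    exact h2⟩⟩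
  loopless := ⟨fun _ h => h.1 rfl⟩

/-- The number of `k`-cliques (complete subgraphs on `k` vertices) of a graph on `Fin n`. -/
def numCliques {n : ℕ} (G : SimpleGraph (Fin n)) (k : ℕ) : ℕ :=
  {s : Finset (Fin n) | G.IsNClique k s}.ncard

/-- The expected number of `k`-cliques of `GIRG(n, β, w₀, d)`. -/
def expectedCliques (lam β w₀ : ℝ) (n d k : ℕ) : ℝ :=
  ∫ ω, (numCliques (girgGraph lam ω) k : ℝ) ∂(girgLaw n β w₀ d)

end

/-! Upper bound. Fix the weights and put ρ_e = min(1, λ w_u w_v / n) for each pair e = uv. In the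
maximum norm a clique must appear in every coordinate, so its probability is the d-th power of a
one-dimensional one. On the circle the events that a pair is too far apart are pairwise independent,
with probabilities 1 - ρ_e^(1/d). Since d ≫ log n these are small, and the second Bonferroni
inequality shows that for at most five vertices the clique probability is at most ∏ ρ_e^σ with σ < 1
close to 1 (`measureReal_positions_clique_le`): edges are almost independent.

With u_i = w_i / √(n/λ), a deterministic inequality (`prod_min_one_rpow_le`) bounds this product by
∏ min(u_i^a, u_i^b), where a and b lie just above and just below the Pareto exponent β - 1. The
bound factorizes over vertices, and each factor has mean O(n^((1-β)/2)). A triangle already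
suffices: each vertex has two edges, which allows a up to 2σ, and 2σ > β - 1 is possible because β <
3. Larger cliques are cut into blocks of three to five vertices; dropping the edges between blocks
makes them independent (`measure_cliqueEvent_le_pow`). So k given vertices form a clique with
probability at most (C n^((1-β)/2))^k, and C(n,k) ≤ (en/k)^k bounds the expectation.

Lower bound. Vertices of weight at least √(n/λ) are pairwise adjacent, and each vertex is this heavy
with probability of order n^((1-β)/2). Cliques of heavy vertices give the matching expectation.

For the clique number, the first moment at a large multiple of n^((3-β)/2) gives the upper bound,
and a Chernoff bound for the number of heavy vertices gives the lower one. -/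

/-! ### Second-order Bonferroni bound -/

instance isProbabilityMeasure_unitAddCircle :
    IsProbabilityMeasure (volume : Measure UnitAddCircle) :=
  ⟨by simp⟩

/-- Second Bonferroni inequality for pairwise independent events. -/
theorem measureReal_biInter_compl_le {Ω κ : Type*} [MeasurableSpace Ω] {μ : Measure Ω}
    [IsProbabilityMeasure μ] (E : Finset κ) (B : κ → Set Ω) (hB : ∀ e ∈ E, MeasurableSet (B e))
    (hind : ∀ e ∈ E, ∀ f ∈ E, e ≠ f → μ.real (B e ∩ B f) = μ.real (B e) * μ.real (B f)) :
    μ.real (⋂ e ∈ E, (B e)ᶜ) ≤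
      1 - ∑ e ∈ E, μ.real (B e) + (∑ e ∈ E, μ.real (B e)) ^ 2 / 2 := by
  classical
  set S := ∑ e ∈ E, μ.real (B e) with hS
  set N : Ω → ℝ := fun ω => ∑ e ∈ E, (B e).indicator (fun _ => (1 : ℝ)) ω with hN
  have hint1 : ∀ A : Set Ω, MeasurableSet A → Integrable (A.indicator (fun _ => (1 : ℝ))) μ :=
    fun A hA => (integrable_const 1).indicator hA
  have hint : ∀ e ∈ E, Integrable ((B e).indicator (fun _ => (1 : ℝ))) μ :=
    fun e he => hint1 _ (hB e he)
  have hNint : Integrable N μ := integrable_finsetSum _ hint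
  have hmul : ∀ e f, ∀ ω, (B e).indicator (fun _ => (1 : ℝ)) ω * (B f).indicator (fun _ => (1 : ℝ)) ω
      = (B e ∩ B f).indicator (fun _ => (1 : ℝ)) ω := by
    intro e f ω
    by_cases h1 : ω ∈ B e <;> by_cases h2 : ω ∈ B f <;> simp [h1, h2]
  have hN2 : ∀ ω, N ω ^ 2 = ∑ e ∈ E, ∑ f ∈ E, (B e ∩ B f).indicator (fun _ => (1 : ℝ)) ω := by
    intro ω
    simp only [hN, sq, Finset.sum_mul_sum, hmul]
  have hint2 : ∀ e ∈ E, ∀ f ∈ E, Integrable ((B e ∩ B f).indicator (fun _ => (1 : ℝ))) μ :=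
    fun e he f hf => hint1 _ ((hB e he).inter (hB f hf))
  have hN2int : Integrable (fun ω => N ω ^ 2) μ := by
    simp only [hN2]
    exact integrable_finsetSum _ fun e he => integrable_finsetSum _ fun f hf => hint2 e he f hf
  have hEN : ∫ ω, N ω ∂μ = S := by
    simp only [hN]
    rw [integral_finsetSum _ hint]
    refine Finset.sum_congr rfl fun e he => ?_
    rw [integral_indicator (hB e he)]; simp
  have hEN2 : ∫ ω, N ω ^ 2 ∂μ ≤ S ^ 2 + S := by
    simp only [hN2]
    rw [integral_finsetSum _ fun e he => integrable_finsetSum _ fun f hf => hint2 e he f hf]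
    have : ∀ e ∈ E, ∫ ω, ∑ f ∈ E, (B e ∩ B f).indicator (fun _ => (1 : ℝ)) ω ∂μ
        ≤ μ.real (B e) * S + μ.real (B e) := by
      intro e he
      rw [integral_finsetSum _ fun f hf => hint2 e he f hf, hS, Finset.mul_sum]
      rw [← Finset.add_sum_erase _ _ he, ← Finset.add_sum_erase E (fun f => μ.real (B e) * _) he]
      have h1 : ∫ ω, (B e ∩ B e).indicator (fun _ => (1 : ℝ)) ω ∂μ = μ.real (B e) := by
        rw [Set.inter_self, integral_indicator (hB e he)]; simp
      have h2 : ∑ f ∈ E.erase e, ∫ ω, (B e ∩ B f).indicator (fun _ => (1 : ℝ)) ω ∂μ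
          = ∑ f ∈ E.erase e, μ.real (B e) * μ.real (B f) := by
        refine Finset.sum_congr rfl fun f hf => ?_
        have hfE := Finset.mem_of_mem_erase hf
        rw [integral_indicator ((hB e he).inter (hB f hfE))]
        simp [hind e he f hfE (Finset.ne_of_mem_erase hf).symm]
      rw [h1, h2]
      have : 0 ≤ μ.real (B e) * μ.real (B e) := by positivity
      linarith
    refine (Finset.sum_le_sum this).trans ?_
    rw [Finset.sum_add_distrib, ← Finset.sum_mul, ← hS, sq]
  have hAm : MeasurableSet (⋂ e ∈ E, (B e)ᶜ) :=
    E.measurableSet_biInter fun e he => (hB e he).compl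
  -- The right side is (1 - N)(2 - N)/2: it equals 1 at N = 0 and is nonnegative at every integer N.
  have key : ∀ ω, (⋂ e ∈ E, (B e)ᶜ).indicator (fun _ => (1 : ℝ)) ω
      ≤ 1 - (3 / 2) * N ω + (1 / 2) * N ω ^ 2 := by
    intro ω
    have hNn : N ω = ((E.filter fun e => ω ∈ B e).card : ℝ) := by
      simp [hN, Set.indicator_apply]
    by_cases h : ω ∈ ⋂ e ∈ E, (B e)ᶜ
    · have : N ω = 0 := by
        rw [hNn, Nat.cast_eq_zero, Finset.card_eq_zero, Finset.filter_eq_empty_iff]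
        simpa using h
      rw [Set.indicator_of_mem h, this]; norm_num
    · rw [Set.indicator_of_notMem h, hNn]
      have hpos : 1 ≤ (E.filter fun e => ω ∈ B e).card := by
        rw [Nat.one_le_iff_ne_zero, Ne, Finset.card_eq_zero, Finset.filter_eq_empty_iff]
        simpa using h
      obtain ⟨m, hm⟩ := Nat.exists_eq_add_of_le hpos
      rw [hm]
      have : (0 : ℝ) ≤ (m : ℝ) * m - m := by
        have : m ≤ m * m := Nat.le_mul_self m
        have : (m : ℝ) ≤ m * m := by exact_mod_cast this
        linarith
      push_cast
      nlinarith
  have hmain : μ.real (⋂ e ∈ E, (B e)ᶜ) ≤ ∫ ω, (1 - (3 / 2) * N ω + (1 / 2) * N ω ^ 2) ∂μ := by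
    rw [← integral_indicator_one hAm]
    exact integral_mono (hint1 _ hAm)
      (((integrable_const 1).sub (hNint.const_mul _)).add (hN2int.const_mul _)) key
  rw [integral_add (f := fun ω => 1 - (3 / 2) * N ω)
      ((integrable_const 1).sub (hNint.const_mul _)) (hN2int.const_mul _),
    integral_sub (integrable_const 1) (hNint.const_mul _), integral_const_mul, integral_const_mul,
    hEN] at hmain
  simp at hmain
  linarith

/-! ### Distances of random points on one circle -/

theorem volume_lt_dist_circle (t : ℝ) (x : UnitAddCircle) :
    volume {z : UnitAddCircle | t < dist x z} = 1 - ENNReal.ofReal (min 1 (2 * t)) := by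
  have : {z : UnitAddCircle | t < dist x z} = (Metric.closedBall x t)ᶜ := by
    ext z; simp [dist_comm]
  rw [this, measure_compl Metric.isClosed_closedBall.measurableSet (measure_ne_top _ _),
    measure_univ, AddCircle.volume_closedBall]

/-- Integrate out the point `y l` first: `F` ignores it, and by translation invariance the measure
of the far region does not depend on `y k`. -/
theorem lintegral_mul_lt_dist_circle {ι : Type*} [Fintype ι] [DecidableEq ι]
    {F : (ι → UnitAddCircle) → ENNReal} (hF : Measurable F) {k l : ι} (hkl : k ≠ l) (t : ℝ)
    (hFl : ∀ y z, F (Function.update y l z) = F y) :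
    ∫⁻ y, F y * {y : ι → UnitAddCircle | t < dist (y k) (y l)}.indicator 1 y =
      (1 - ENNReal.ofReal (min 1 (2 * t))) * ∫⁻ y, F y := by
  have hm : MeasurableSet {y : ι → UnitAddCircle | t < dist (y k) (y l)} :=
    measurableSet_lt measurable_const (by fun_prop)
  rw [← lintegral_const_mul _ hF, volume_pi]
  refine lintegral_eq_of_lmarginal_eq {l} (hF.mul (measurable_one.indicator hm))
    (hF.const_mul _) ?_
  rw [lmarginal_singleton, lmarginal_singleton]
  ext y
  simp only [hFl]
  have : ∀ z, F y * {y : ι → UnitAddCircle | t < dist (y k) (y l)}.indicator 1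
      (Function.update y l z) = F y * {z : UnitAddCircle | t < dist (y k) z}.indicator 1 z := by
    intro z
    congr 1
    simp [Set.indicator_apply, Function.update_of_ne hkl]
  simp only [this]
  rw [lintegral_const_mul _ (measurable_one.indicator
    (measurableSet_lt measurable_const (by fun_prop))), lintegral_indicator_one
    (measurableSet_lt measurable_const (by fun_prop)), volume_lt_dist_circle]
  simp [mul_comm]

theorem measureReal_lt_dist_circle {ι : Type*} [Fintype ι] [DecidableEq ι] {k l : ι} (hkl : k ≠ l)
    {t : ℝ} (ht : 0 ≤ t) :
    (volume : Measure (ι → UnitAddCircle)).real {y | t < dist (y k) (y l)} = 1 - min 1 (2 * t) := by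
  have hm : MeasurableSet {y : ι → UnitAddCircle | t < dist (y k) (y l)} :=
    measurableSet_lt measurable_const (by fun_prop)
  have h := lintegral_mul_lt_dist_circle (F := fun _ => 1) measurable_const hkl t (fun _ _ => rfl)
  simp only [one_mul, lintegral_indicator_one hm, lintegral_const, measure_univ, mul_one] at h
  rw [measureReal_def, h, ENNReal.toReal_sub_of_le (by simp) (by simp),
    ENNReal.toReal_ofReal (by positivity)]
  simp

/-- It is enough that one endpoint of the second pair is missing from the first; two different pairs
always allow this, up to swapping endpoints. -/
theorem measureReal_lt_dist_circle_inter {ι : Type*} [Fintype ι] [DecidableEq ι] {i j k l : ι}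
    (hkl : k ≠ l) (hil : i ≠ l) (hjl : j ≠ l) (t : ℝ) {u : ℝ} (hu : 0 ≤ u) :
    (volume : Measure (ι → UnitAddCircle)).real
      ({y | t < dist (y i) (y j)} ∩ {y | u < dist (y k) (y l)}) =
    (volume : Measure (ι → UnitAddCircle)).real {y | t < dist (y i) (y j)} *
    (volume : Measure (ι → UnitAddCircle)).real {y | u < dist (y k) (y l)} := by
  have hm : ∀ (t : ℝ) (k l : ι), MeasurableSet {y : ι → UnitAddCircle | t < dist (y k) (y l)} :=
    fun t k l => measurableSet_lt measurable_const (by fun_prop)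
  have h := lintegral_mul_lt_dist_circle
    (F := {y : ι → UnitAddCircle | t < dist (y i) (y j)}.indicator 1)
    (measurable_one.indicator (hm t i j)) hkl u
    (fun y z => by simp [Set.indicator_apply, Function.update_of_ne hil, Function.update_of_ne hjl])
  have h2 : ∀ y, {y : ι → UnitAddCircle | t < dist (y i) (y j)}.indicator
      (1 : (ι → UnitAddCircle) → ENNReal) y *
      {y : ι → UnitAddCircle | u < dist (y k) (y l)}.indicator 1 y =
      ({y | t < dist (y i) (y j)} ∩ {y | u < dist (y k) (y l)}).indicator 1 y := by
    intro y
    rw [Set.inter_indicator_one]; rfl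
  simp only [h2] at h
  rw [lintegral_indicator_one ((hm t i j).inter (hm u k l)), lintegral_indicator_one (hm t i j)] at h
  rw [measureReal_lt_dist_circle hkl hu, measureReal_def, h, ENNReal.toReal_mul,
    ENNReal.toReal_sub_of_le (by simp) (by simp), ENNReal.toReal_ofReal (by positivity), mul_comm]
  simp [measureReal_def]

/-- The pairs of elements of `s`, each listed once. -/
def orderedPairs {ι : Type*} [LinearOrder ι] (s : Finset ι) : Finset (ι × ι) :=
  s.offDiag.filter fun e => e.1 < e.2

theorem mem_orderedPairs {ι : Type*} [LinearOrder ι] {s : Finset ι} {e : ι × ι} :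
    e ∈ orderedPairs s ↔ e.1 ∈ s ∧ e.2 ∈ s ∧ e.1 < e.2 := by
  simp only [orderedPairs, Finset.mem_filter, Finset.mem_offDiag]
  exact ⟨fun h => ⟨h.1.1, h.1.2.1, h.2⟩, fun h => ⟨⟨h.1, h.2.1, h.2.2.ne⟩, h.2.2⟩⟩

theorem measureReal_circle_clique_le {ι : Type*} [Fintype ι] [LinearOrder ι] (s : Finset ι)
    (t : ι × ι → ℝ) (ht : ∀ e, 0 ≤ t e) :
    (volume : Measure (ι → UnitAddCircle)).real
        {y | ∀ e ∈ orderedPairs s, dist (y e.1) (y e.2) ≤ t e} ≤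
      1 - ∑ e ∈ orderedPairs s, (1 - min 1 (2 * t e)) +
        (∑ e ∈ orderedPairs s, (1 - min 1 (2 * t e))) ^ 2 / 2 := by
  have h := measureReal_biInter_compl_le (μ := (volume : Measure (ι → UnitAddCircle)))
    (orderedPairs s) (fun e => {y | t e < dist (y e.1) (y e.2)})
    (fun e _ => measurableSet_lt measurable_const (by fun_prop)) ?_
  · have h1 : ∀ e ∈ orderedPairs s, (volume : Measure (ι → UnitAddCircle)).real
        {y | t e < dist (y e.1) (y e.2)} = 1 - min 1 (2 * t e) := fun e he =>
      measureReal_lt_dist_circle (mem_orderedPairs.1 he).2.2.ne (ht e)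
    rw [Finset.sum_congr rfl h1] at h
    convert h using 2
    ext y; simp
  · intro e he f hf hef
    have he' := (mem_orderedPairs.1 he).2.2
    have hf' := (mem_orderedPairs.1 hf).2.2
    by_cases h2 : e.1 ≠ f.2 ∧ e.2 ≠ f.2
    · exact measureReal_lt_dist_circle_inter hf'.ne h2.1 h2.2 _ (ht f)
    -- If both endpoints of `f` were in `e`, the increasing order within pairs would force `e = f`.
    · have h1 : e.1 ≠ f.1 ∧ e.2 ≠ f.1 := by
        by_contra h1
        have : e.1 = f.1 ∧ e.2 = f.2 := by grind
        exact hef (Prod.ext this.1 this.2)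
      have := measureReal_lt_dist_circle_inter hf'.ne' h1.1 h1.2 (t e) (ht f)
      simpa only [dist_comm (_ : UnitAddCircle), dist_comm] using this

/-! ### From one coordinate to the torus -/

theorem measurePreserving_swap_pi {ι κ X : Type*} [Fintype ι] [Fintype κ] [MeasureSpace X]
    [IsProbabilityMeasure (volume : Measure X)] :
    MeasurePreserving (fun (x : ι → κ → X) (c : κ) (i : ι) => x i c) volume volume := by
  refine ⟨by fun_prop, ?_⟩
  have h1 := Measure.infinitePi_map_curry_symm (fun (_ : ι) (_ : κ) => (volume : Measure X))
  have h2 := Measure.infinitePi_map_curry (fun (_ : κ) (_ : ι) => (volume : Measure X))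
  have h3 := Measure.map_infinitePi_infinitePi_of_inj (α := κ × ι) (Ω := fun _ : ι × κ => X)
    (P := fun _ => volume) (f := Prod.swap) Prod.swap_injective
  simp only [Measure.infinitePi_eq_pi] at h1 h2 h3
  simp only [volume_pi]
  rw [← h2, ← h3, ← h1, Measure.map_map (by fun_prop) (by fun_prop),
    Measure.map_map (by fun_prop) (by fun_prop)]
  rfl

theorem volume_forall_slice_mem {ι κ X : Type*} [Fintype ι] [Fintype κ] [MeasureSpace X]
    [IsProbabilityMeasure (volume : Measure X)] {A : Set (ι → X)} (hA : MeasurableSet A) :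
    (volume : Measure (ι → κ → X)).real {x | ∀ c, (fun i => x i c) ∈ A} =
      (volume : Measure (ι → X)).real A ^ Fintype.card κ := by
  have h := (measurePreserving_swap_pi (ι := ι) (κ := κ) (X := X)).measure_preimage
    (s := Set.univ.pi fun _ => A) (MeasurableSet.univ_pi fun _ => hA).nullMeasurableSet
  rw [volume_pi_pi, Finset.prod_const, Finset.card_univ] at h
  rw [measureReal_def, measureReal_def, ← ENNReal.toReal_pow, ← h]
  congr 2
  ext x; simp

theorem mul_one_sub_le_one_sub_exp_neg {z : ℝ} (hz : 0 ≤ z) : z * (1 - z) ≤ 1 - Real.exp (-z) := by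
  have h1 : Real.exp (-z) * (1 + z) ≤ 1 := by
    have := Real.add_one_le_exp z
    calc Real.exp (-z) * (1 + z) ≤ Real.exp (-z) * Real.exp z := by
          gcongr; linarith
      _ = 1 := by rw [← Real.exp_add]; simp
  have h2 := Real.exp_pos (-z)
  by_contra! h
  nlinarith [mul_nonneg hz hz, mul_nonneg hz (mul_nonneg hz hz)]

/-- Writing ρ_e = exp(-d z_e) with 0 ≤ z_e ≤ τ, the base is 1 - Z up to relative errors O(τ) in Z =
∑ z_e, so its d-th power is close to exp(-dZ) = ∏ ρ_e. The exponent `σ` absorbs the errors. -/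
theorem one_sub_sum_add_sq_pow_le {κ : Type*} (E : Finset κ) (hE : E.card ≤ 25) {ρ : κ → ℝ}
    (h0 : ∀ e ∈ E, 0 < ρ e) (h1 : ∀ e ∈ E, ρ e ≤ 1) {d : ℕ} (hd : 1 ≤ d) {τ σ : ℝ}
    (hτ0 : 0 ≤ τ) (hτ : ∀ e ∈ E, -Real.log (ρ e) ≤ τ * d) (hσ : σ ≤ 1 - 14 * τ) (hσ0 : 0 ≤ σ) :
    (1 - ∑ e ∈ E, (1 - ρ e ^ (1 / (d : ℝ))) + (∑ e ∈ E, (1 - ρ e ^ (1 / (d : ℝ)))) ^ 2 / 2) ^ d ≤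
      ∏ e ∈ E, ρ e ^ σ := by
  have hd0 : (0 : ℝ) < d := by exact_mod_cast hd
  set z : κ → ℝ := fun e => -Real.log (ρ e) / d with hz
  have hz0 : ∀ e ∈ E, 0 ≤ z e := fun e he =>
    div_nonneg (by have := Real.log_nonpos (h0 e he).le (h1 e he); linarith) hd0.le
  have hzτ : ∀ e ∈ E, z e ≤ τ := fun e he => by
    rw [hz]; simp only; rw [div_le_iff₀ hd0]; exact hτ e he
  have hρ : ∀ e ∈ E, ρ e ^ (1 / (d : ℝ)) = Real.exp (-z e) := fun e he => by
    rw [Real.rpow_def_of_pos (h0 e he), hz]; congr 1; ring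
  rw [Finset.sum_congr rfl fun e he => by rw [hρ e he]]
  set S := ∑ e ∈ E, (1 - Real.exp (-z e)) with hS
  set Z := ∑ e ∈ E, z e with hZ
  have hZ0 : 0 ≤ Z := Finset.sum_nonneg hz0
  have hZle : Z ≤ 25 * τ := by
    calc Z ≤ E.card • τ := Finset.sum_le_card_nsmul _ _ _ hzτ
      _ = E.card * τ := by simp
      _ ≤ 25 * τ := by gcongr; exact_mod_cast hE
  have hSZ : S ≤ Z := Finset.sum_le_sum fun e _ => by
    have := Real.add_one_le_exp (-z e); linarith
  have hSge : (1 - τ) * Z ≤ S := by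
    rw [hS, hZ, Finset.mul_sum]
    refine Finset.sum_le_sum fun e he => ?_
    have h := mul_one_sub_le_one_sub_exp_neg (hz0 e he)
    nlinarith [hz0 e he, hzτ e he]
  have hS0 : 0 ≤ S := Finset.sum_nonneg fun e he => by
    have := Real.exp_le_one_iff.2 (neg_nonpos.2 (hz0 e he)); linarith
  have hmain : σ * Z ≤ S - S ^ 2 / 2 := by
    have hτ1 : τ ≤ 1 / 14 := by linarith
    -- Here S ≤ Z ≤ 25τ. Together with the loss 1 - τ in S ≥ (1 - τ)Z, the total factor is at least
    -- 1 - 13.5τ, whence the 14.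
    have : S * (1 - 25 / 2 * τ) ≤ S - S ^ 2 / 2 := by nlinarith
    have h3 : (1 - τ) * Z * (1 - 25 / 2 * τ) ≤ S * (1 - 25 / 2 * τ) :=
      mul_le_mul_of_nonneg_right hSge (by linarith)
    have h4 : σ * Z ≤ (1 - τ) * Z * (1 - 25 / 2 * τ) := by
      have : σ ≤ (1 - τ) * (1 - 25 / 2 * τ) := by nlinarith
      nlinarith
    linarith
  calc (1 - S + S ^ 2 / 2) ^ d ≤ Real.exp (-(σ * Z)) ^ d := by
        refine pow_le_pow_left₀ (by nlinarith [sq_nonneg (S - 1)]) ?_ d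
        have := Real.add_one_le_exp (-(S - S ^ 2 / 2))
        have h5 : Real.exp (-(S - S ^ 2 / 2)) ≤ Real.exp (-(σ * Z)) :=
          Real.exp_le_exp.2 (by linarith)
        linarith
    _ = ∏ e ∈ E, ρ e ^ σ := by
        rw [← Real.exp_nat_mul, Finset.prod_congr rfl fun e he => Real.rpow_def_of_pos (h0 e he) σ,
          ← Real.exp_sum, hZ, ← Finset.sum_mul]
        congr 1
        have : (d : ℝ) * ∑ e ∈ E, z e = - ∑ e ∈ E, Real.log (ρ e) := by
          rw [Finset.mul_sum, ← Finset.sum_neg_distrib]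
          exact Finset.sum_congr rfl fun e _ => by rw [hz]; field_simp
        linear_combination (-σ) * this

theorem min_one_rpow {x : ℝ} (hx : 0 ≤ x) {p : ℝ} (hp : 0 ≤ p) :
    min 1 (x ^ p) = (min 1 x) ^ p := by
  rcases le_total 1 x with h | h
  · rw [min_eq_left h, min_eq_left (Real.one_le_rpow h hp), Real.one_rpow]
  · rw [min_eq_right h, min_eq_right (Real.rpow_le_one hx h hp)]

theorem measureReal_positions_clique_le {lam w₀ τ σ : ℝ} {n d : ℕ} (hlam : 0 < lam) (hw₀ : 0 < w₀)
    (hn : 1 ≤ n) (hd : 1 ≤ d) (hτ0 : 0 ≤ τ) (hτ : -Real.log (lam * w₀ * w₀ / n) ≤ τ * d)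
    (hσ : σ ≤ 1 - 14 * τ) (hσ0 : 0 ≤ σ) (s : Finset (Fin n)) (hs : s.card ≤ 5) {w : Fin n → ℝ}
    (hw : ∀ i, w₀ ≤ w i) :
    (volume : Measure (Fin n → Fin d → UnitAddCircle)).real
        {x | ∀ e ∈ orderedPairs s, dist (x e.1) (x e.2) ≤
          connectionThreshold lam n d (w e.1) (w e.2)} ≤
      ∏ e ∈ orderedPairs s, (min 1 (lam * w e.1 * w e.2 / n)) ^ σ := by
  have hn0 : (0 : ℝ) < n := by exact_mod_cast hn
  have hwp : ∀ i, 0 < w i := fun i => hw₀.trans_le (hw i)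
  have hκ : ∀ e : Fin n × Fin n, 0 < lam * w e.1 * w e.2 / n := fun e => by
    have := hwp e.1; have := hwp e.2; positivity
  set t : Fin n × Fin n → ℝ := fun e => connectionThreshold lam n d (w e.1) (w e.2) with ht
  have ht0 : ∀ e, 0 ≤ t e := fun e => by
    have := hκ e
    simp only [ht, connectionThreshold]; positivity
  have hA : MeasurableSet {y : Fin n → UnitAddCircle |
      ∀ e ∈ orderedPairs s, dist (y e.1) (y e.2) ≤ t e} := by
    simp only [Set.ofPred_forall]
    exact (orderedPairs s).measurableSet_biInter fun e _ =>
      measurableSet_le (by fun_prop) measurable_const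
  have hset : {x : Fin n → Fin d → UnitAddCircle | ∀ e ∈ orderedPairs s, dist (x e.1) (x e.2) ≤ t e}
      = {x | ∀ c, (fun i => x i c) ∈ {y : Fin n → UnitAddCircle |
          ∀ e ∈ orderedPairs s, dist (y e.1) (y e.2) ≤ t e}} := by
    ext x
    simp only [Set.mem_ofPred_eq, dist_pi_le_iff (ht0 _)]
    exact ⟨fun h c e he => h e he c, fun h e he c => h c e he⟩
  have h2t : ∀ e, min 1 (2 * t e) = (min 1 (lam * w e.1 * w e.2 / n)) ^ (1 / (d : ℝ)) := fun e => by
    rw [← min_one_rpow (hκ e).le (by positivity)]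
    simp only [ht, connectionThreshold]; congr 1; ring
  rw [hset, volume_forall_slice_mem hA, Fintype.card_fin]
  have h1 := measureReal_circle_clique_le s t ht0
  simp only [h2t] at h1
  refine (pow_le_pow_left₀ measureReal_nonneg h1 d).trans ?_
  refine one_sub_sum_add_sq_pow_le _ ?_ (fun e _ => lt_min one_pos (hκ e))
    (fun e _ => min_le_left _ _) hd hτ0 (fun e _ => ?_) hσ hσ0
  · calc (orderedPairs s).card ≤ s.offDiag.card := Finset.card_filter_le _ _
      _ ≤ s.card * s.card := by rw [Finset.offDiag_card]; exact Nat.sub_le _ _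
      _ ≤ 25 := Nat.mul_le_mul hs hs
  · rcases le_total 1 (lam * w e.1 * w e.2 / n) with h | h
    · rw [min_eq_left h]; simp; positivity
    · rw [min_eq_right h]
      refine le_trans (neg_le_neg (Real.log_le_log (by positivity) ?_)) hτ
      have h3 : lam * w₀ ≤ lam * w e.1 := mul_le_mul_of_nonneg_left (hw _) hlam.le
      have h4 := mul_le_mul h3 (hw e.2) hw₀.le (mul_pos hlam (hwp _)).le
      gcongr

/-! ### Decoupling a product over pairs into a product over vertices -/

theorem sum_orderedPairs_insert {ι : Type*} [LinearOrder ι] {s : Finset ι} {v : ι} (hv : v ∉ s)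
    {f : ι × ι → ℝ} (hf : ∀ i j, f (i, j) = f (j, i)) :
    ∑ e ∈ orderedPairs (insert v s), f e = ∑ e ∈ orderedPairs s, f e + ∑ i ∈ s, f (v, i) := by
  have himg : ∑ i ∈ s, f (v, i) = ∑ e ∈ s.image (fun i => if v < i then (v, i) else (i, v)), f e := by
    rw [Finset.sum_image]
    · refine Finset.sum_congr rfl fun i _ => ?_
      split_ifs
      · rfl
      · exact hf _ _
    · intro i hi j hj hij
      have hi' : i ≠ v := fun h => hv (h ▸ hi)
      simp only at hij
      split_ifs at hij <;> simp_all
  rw [himg, ← Finset.sum_union]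
  · refine Finset.sum_congr ?_ fun _ _ => rfl
    ext ⟨i, j⟩
    simp only [mem_orderedPairs, Finset.mem_union, Finset.mem_image, Finset.mem_insert]
    constructor
    · rintro ⟨rfl | hi, rfl | hj, hij⟩
      · exact absurd hij (lt_irrefl _)
      · exact Or.inr ⟨j, hj, if_pos hij⟩
      · exact Or.inr ⟨i, hi, if_neg hij.not_gt⟩
      · exact Or.inl ⟨hi, hj, hij⟩
    · rintro (⟨hi, hj, hij⟩ | ⟨k, hk, h⟩)
      · exact ⟨Or.inr hi, Or.inr hj, hij⟩
      · have hkv : k ≠ v := fun h => hv (h ▸ hk)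
        split_ifs at h with h1
        · obtain ⟨rfl, rfl⟩ := Prod.mk.inj h
          exact ⟨Or.inl rfl, Or.inr hk, h1⟩
        · obtain ⟨rfl, rfl⟩ := Prod.mk.inj h
          exact ⟨Or.inr hk, Or.inl rfl, lt_of_le_of_ne (not_lt.1 h1) hkv⟩
  · rw [Finset.disjoint_left]
    intro e he he'
    rw [mem_orderedPairs] at he
    obtain ⟨k, _, h⟩ := Finset.mem_image.1 he'
    split_ifs at h <;> subst h <;> simp_all

section Exponents

variable {a b σ : ℝ}

theorem mul_min_zero_le {c t : ℝ} (hc0 : 0 ≤ c) (hc : c ≤ σ) : σ * min 0 t ≤ c * t := by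
  rcases le_total 0 t with h | h
  · rw [min_eq_left h, mul_zero]; positivity
  · rw [min_eq_right h]; exact mul_le_mul_of_nonpos_right hc h

theorem min_mul_right_of_nonneg {x : ℝ} (hba : b ≤ a) (hx : 0 ≤ x) : min (a * x) (b * x) = b * x :=
  min_eq_right (mul_le_mul_of_nonneg_right hba hx)

theorem min_mul_left_of_nonpos {x : ℝ} (hba : b ≤ a) (hx : x ≤ 0) : min (a * x) (b * x) = a * x :=
  min_eq_left (mul_le_mul_of_nonpos_right hba hx)

/-- Each term σ·min(0, t) may be replaced by c·t for any 0 ≤ c ≤ σ, or by 0. The choice of c depends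
on the signs so that every negative variable gets coefficient at least a and no positive one gets
more than b: c = a - σ on the edges at x if only x is positive, c = a/2 on the edges at z if only z
is negative. -/
theorem triangle_exponent_le (hb : 0 < b) (hba : b ≤ a) (hσa : σ ≤ a) (ha : a ≤ 2 * σ)
    (hab : 2 * (a - σ) ≤ b) (hab' : a ≤ 2 * b) {x y z : ℝ} (hyx : y ≤ x) (hzx : z ≤ x) :
    σ * min 0 (x + y) + σ * min 0 (x + z) + σ * min 0 (y + z) ≤
      min (a * x) (b * x) + min (a * y) (b * y) + min (a * z) (b * z) := by
  wlog hyz : z ≤ y generalizing y z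
  · have := this hzx hyx (le_of_not_ge hyz)
    rw [add_comm z y] at this
    linarith
  have hσ : 0 ≤ σ := by linarith
  have hnp : ∀ t, σ * min 0 t ≤ 0 := fun t => mul_nonpos_of_nonneg_of_nonpos hσ (min_le_left _ _)
  have h1 : ∀ t, σ * min 0 t ≤ σ * t := fun t => mul_min_zero_le hσ le_rfl
  rcases le_total x 0 with hx | hx
  · rw [min_mul_left_of_nonpos hba hx, min_mul_left_of_nonpos hba (hyx.trans hx),
      min_mul_left_of_nonpos hba (hzx.trans hx)]
    have := h1 (x + y); have := h1 (x + z); have := h1 (y + z)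
    have : (2 * σ - a) * (x + y + z) ≤ 0 :=
      mul_nonpos_of_nonneg_of_nonpos (by linarith) (by linarith)
    linarith
  rw [min_mul_right_of_nonneg hba hx]
  rcases le_total y 0 with hy | hy
  · rw [min_mul_left_of_nonpos hba hy, min_mul_left_of_nonpos hba (hyz.trans hy)]
    have h2 : ∀ t, σ * min 0 t ≤ (a - σ) * t := fun t =>
      mul_min_zero_le (by linarith) (by linarith)
    have := h2 (x + y); have := h2 (x + z); have := h1 (y + z)
    have : 2 * (a - σ) * x ≤ b * x := mul_le_mul_of_nonneg_right hab hx
    linarith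
  rw [min_mul_right_of_nonneg hba hy]
  rcases le_total z 0 with hz | hz
  · rw [min_mul_left_of_nonpos hba hz]
    have h2 : ∀ t, σ * min 0 t ≤ (a / 2) * t := fun t =>
      mul_min_zero_le (by linarith) (by linarith)
    have := hnp (x + y); have := h2 (x + z); have := h2 (y + z)
    have : a / 2 * (x + y) ≤ b * (x + y) := mul_le_mul_of_nonneg_right (by linarith) (by linarith)
    linarith
  · rw [min_mul_right_of_nonneg hba hz]
    have := hnp (x + y); have := hnp (x + z); have := hnp (y + z)
    have : 0 ≤ b * x := by positivity
    have : 0 ≤ b * y := by positivity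
    have : 0 ≤ b * z := by positivity
    linarith

/-- Remove a vertex v of maximal x. If x_v ≥ 0, its edges contribute at most 0. Otherwise all others
are at most x_v < 0, and at least two of its edges contribute at most σ x_v each, which pays for a
x_v. The induction stops at triangles. -/
theorem clique_exponent_le {ι : Type*} [LinearOrder ι] (hb : 0 < b) (hba : b ≤ a) (hσa : σ ≤ a)
    (ha : a ≤ 2 * σ) (hab : 2 * (a - σ) ≤ b) (hab' : a ≤ 2 * b) (x : ι → ℝ) (s : Finset ι)
    (hs : 3 ≤ s.card) :
    ∑ e ∈ orderedPairs s, σ * min 0 (x e.1 + x e.2) ≤ ∑ i ∈ s, min (a * x i) (b * x i) := by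
  have hσ : 0 ≤ σ := by linarith
  have hf : ∀ i j, σ * min 0 (x i + x j) = σ * min 0 (x j + x i) := fun i j => by rw [add_comm]
  induction s using Finset.induction_on_max_value x with
  | empty => simp at hs
  | insert v s hv hmax ih =>
    have hpairs := sum_orderedPairs_insert hv (f := fun e => σ * min 0 (x e.1 + x e.2)) hf
    rw [hpairs, Finset.sum_insert hv]
    rw [Finset.card_insert_of_notMem hv] at hs
    by_cases h3 : 3 ≤ s.card
    · have h := ih h3
      have h2 : ∑ i ∈ s, σ * min 0 (x v + x i) ≤ min (a * x v) (b * x v) := by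
        rcases le_total 0 (x v) with hx | hx
        · rw [min_mul_right_of_nonneg hba hx]
          refine le_trans (Finset.sum_nonpos fun i _ => ?_) (by positivity : 0 ≤ b * x v)
          exact mul_nonpos_of_nonneg_of_nonpos hσ (min_le_left _ _)
        · rw [min_mul_left_of_nonpos hba hx]
          calc ∑ i ∈ s, σ * min 0 (x v + x i) ≤ ∑ i ∈ s, σ * x v := by
                refine Finset.sum_le_sum fun i hi => ?_
                have := hmax i hi
                exact mul_le_mul_of_nonneg_left ((min_le_right _ _).trans (by linarith)) hσ
            _ = s.card * (σ * x v) := by simp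
            _ ≤ 2 * (σ * x v) := by
                refine mul_le_mul_of_nonpos_right ?_ (mul_nonpos_of_nonneg_of_nonpos hσ hx)
                exact_mod_cast (by omega : 2 ≤ s.card)
            _ ≤ a * x v := by
                rw [← mul_assoc]; exact mul_le_mul_of_nonpos_right ha hx
      linarith
    · obtain ⟨p, q, hpq, rfl⟩ := Finset.card_eq_two.1 (by omega : s.card = 2)
      have hq := sum_orderedPairs_insert (s := {q}) (v := p) (by simpa using hpq)
        (f := fun e => σ * min 0 (x e.1 + x e.2)) hf
      have hq' : orderedPairs ({q} : Finset ι) = ∅ := by simp [orderedPairs]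
      rw [hq, hq', Finset.sum_pair hpq, Finset.sum_pair hpq]
      have := triangle_exponent_le hb hba hσa ha hab hab' (hmax p (by simp)) (hmax q (by simp))
      simp only [Finset.sum_empty, Finset.sum_singleton]
      linarith

theorem prod_min_one_rpow_le {ι : Type*} [LinearOrder ι] (hb : 0 < b) (hba : b ≤ a) (hσa : σ ≤ a)
    (ha : a ≤ 2 * σ) (hab : 2 * (a - σ) ≤ b) (hab' : a ≤ 2 * b) {u : ι → ℝ} (hu : ∀ i, 0 < u i)
    (s : Finset ι) (hs : 3 ≤ s.card) :
    ∏ e ∈ orderedPairs s, (min 1 (u e.1 * u e.2)) ^ σ ≤ ∏ i ∈ s, min (u i ^ a) (u i ^ b) := by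
  have h := Real.exp_le_exp.2
    (clique_exponent_le hb hba hσa ha hab hab' (fun i => Real.log (u i)) s hs)
  rw [Real.exp_sum, Real.exp_sum] at h
  convert h using 2 with e _ i _
  · rw [Real.rpow_def_of_pos (lt_min one_pos (mul_pos (hu _) (hu _))), mul_comm,
      ← Real.log_mul (hu _).ne' (hu _).ne']
    congr 2
    rcases le_total 1 (u e.1 * u e.2) with h1 | h1
    · rw [min_eq_left h1, Real.log_one, min_eq_left (Real.log_nonneg h1)]
    · rw [min_eq_right h1, min_eq_right (Real.log_nonpos (mul_pos (hu _) (hu _)).le h1)]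
  · rw [Real.exp_monotone.map_min, Real.rpow_def_of_pos (hu i), Real.rpow_def_of_pos (hu i),
      mul_comm a, mul_comm b]

end Exponents

/-! ### Pareto integral of the vertex factor -/

theorem ae_le_paretoMeasure (t γ : ℝ) : ∀ᵐ w ∂(paretoMeasure t γ), t ≤ w := by
  rw [paretoMeasure, ae_withDensity_iff (by unfold paretoPDF; fun_prop)]
  refine ae_of_all _ fun w hw => ?_
  by_contra! h
  exact hw (paretoPDF_of_lt h)

/-- Against the density, the exponent γ + η leaves w^(η-1), integrable at 0, and γ - η leaves
w^(-η-1), integrable at ∞. Splitting at r, each half has order r^(-γ). -/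
theorem lintegral_min_rpow_paretoMeasure_le {t γ η r : ℝ} (ht : 0 < t) (hγ : 0 < γ) (hη : 0 < η)
    (hr : 0 < r) :
    ∫⁻ w, ENNReal.ofReal (min ((w / r) ^ (γ + η)) ((w / r) ^ (γ - η))) ∂(paretoMeasure t γ) ≤
      ENNReal.ofReal (γ * t ^ γ * (2 / η) * r ^ (-γ)) := by
  have hK : 0 ≤ γ * t ^ γ := by positivity
  have hm : Measurable (paretoPDF t γ) := by unfold paretoPDF; fun_prop
  rw [paretoMeasure, lintegral_withDensity_eq_lintegral_mul _ hm (by fun_prop)]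
  have h1 : ∫⁻ w in Set.Ioc 0 r, ENNReal.ofReal (γ * t ^ γ * r ^ (-(γ + η)) * w ^ (η - 1)) =
      ENNReal.ofReal (γ * t ^ γ * (1 / η) * r ^ (-γ)) := by
    have hint : IntervalIntegrable (fun w : ℝ => w ^ (η - 1)) volume 0 r :=
      intervalIntegral.intervalIntegrable_rpow' (by linarith)
    rw [intervalIntegrable_iff_integrableOn_Ioc_of_le hr.le] at hint
    rw [← ofReal_integral_eq_lintegral_ofReal (hint.const_mul _), integral_const_mul,
      ← intervalIntegral.integral_of_le hr.le, integral_rpow (Or.inl (by linarith))]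
    · congr 1
      rw [sub_add_cancel, Real.zero_rpow hη.ne', sub_zero,
        show γ * t ^ γ * r ^ (-(γ + η)) * (r ^ η / η) =
          γ * t ^ γ * (1 / η) * (r ^ (-(γ + η)) * r ^ η) by ring, ← Real.rpow_add hr]
      congr 2; ring
    · filter_upwards [ae_restrict_mem measurableSet_Ioc] with w hw
      have := hw.1
      simp only [Pi.zero_apply]; positivity
  have h2 : ∫⁻ w in Set.Ioi r, ENNReal.ofReal (γ * t ^ γ * r ^ (-(γ - η)) * w ^ (-η - 1)) =
      ENNReal.ofReal (γ * t ^ γ * (1 / η) * r ^ (-γ)) := by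
    have hint : IntegrableOn (fun w : ℝ => w ^ (-η - 1)) (Set.Ioi r) volume :=
      integrableOn_Ioi_rpow_of_lt (by linarith) hr
    rw [← ofReal_integral_eq_lintegral_ofReal (hint.const_mul _), integral_const_mul,
      integral_Ioi_rpow_of_lt (by linarith) hr]
    · congr 1
      rw [sub_add_cancel, neg_div_neg_eq,
        show γ * t ^ γ * r ^ (-(γ - η)) * (r ^ (-η) / η) =
          γ * t ^ γ * (1 / η) * (r ^ (-(γ - η)) * r ^ (-η)) by ring, ← Real.rpow_add hr]
      congr 2; ring
    · filter_upwards [ae_restrict_mem measurableSet_Ioi] with w hw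
      have : 0 < w := hr.trans hw
      simp only [Pi.zero_apply]; positivity
  have hpow : ∀ {w : ℝ}, 0 < w → ∀ c, w ^ (-(γ + 1)) * (w / r) ^ c = r ^ (-c) * w ^ (c - γ - 1) := by
    intro w hw c
    rw [Real.div_rpow hw.le hr.le, Real.rpow_neg hr.le, div_eq_mul_inv,
      show w ^ (-(γ + 1)) * (w ^ c * (r ^ c)⁻¹) = (r ^ c)⁻¹ * (w ^ (-(γ + 1)) * w ^ c) by ring,
      ← Real.rpow_add hw]
    congr 2; ring
  calc _ ≤ ∫⁻ w, ((Set.Ioc 0 r).indicator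
            (fun w => ENNReal.ofReal (γ * t ^ γ * r ^ (-(γ + η)) * w ^ (η - 1))) w +
          (Set.Ioi r).indicator
            (fun w => ENNReal.ofReal (γ * t ^ γ * r ^ (-(γ - η)) * w ^ (-η - 1))) w) := by
        refine lintegral_mono fun w => ?_
        rcases lt_or_ge w t with hwt | hwt
        · simp [paretoPDF_of_lt hwt]
        have hw : 0 < w := ht.trans_le hwt
        simp only [Pi.mul_apply]
        rw [paretoPDF_of_le hwt, ← ENNReal.ofReal_mul (by positivity)]
        rcases le_or_gt w r with hwr | hwr
        · rw [Set.indicator_of_mem (show w ∈ Set.Ioc 0 r from ⟨hw, hwr⟩)]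
          refine le_add_right (ENNReal.ofReal_le_ofReal ?_)
          calc γ * t ^ γ * w ^ (-(γ + 1)) * min ((w / r) ^ (γ + η)) ((w / r) ^ (γ - η))
              ≤ γ * t ^ γ * w ^ (-(γ + 1)) * (w / r) ^ (γ + η) := by
                gcongr; exact min_le_left _ _
            _ = _ := by
                rw [mul_assoc, hpow hw, ← mul_assoc]; congr 2; ring
        · rw [Set.indicator_of_mem (show w ∈ Set.Ioi r from hwr)]
          refine le_add_left (ENNReal.ofReal_le_ofReal ?_)
          calc γ * t ^ γ * w ^ (-(γ + 1)) * min ((w / r) ^ (γ + η)) ((w / r) ^ (γ - η))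
              ≤ γ * t ^ γ * w ^ (-(γ + 1)) * (w / r) ^ (γ - η) := by
                gcongr; exact min_le_right _ _
            _ = _ := by
                rw [mul_assoc, hpow hw, ← mul_assoc]; congr 2; ring
    _ = _ := by
        rw [lintegral_add_left (Measurable.indicator (by fun_prop) measurableSet_Ioc),
          lintegral_indicator measurableSet_Ioc, lintegral_indicator measurableSet_Ioi, h1, h2,
          ← ENNReal.ofReal_add (by positivity) (by positivity)]
        congr 1; ring

/-! ### Probability that given vertices form a clique -/

/-- The event that the vertices in `s` are pairwise adjacent. -/
def cliqueEvent (lam : ℝ) {n d : ℕ} (s : Finset (Fin n)) : Set (Fin n → GIRGVertex d) :=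
  {ω | (girgGraph lam ω).IsClique s}

theorem mem_cliqueEvent {lam : ℝ} {n d : ℕ} {s : Finset (Fin n)} {ω : Fin n → GIRGVertex d} :
    ω ∈ cliqueEvent lam s ↔ ∀ i ∈ s, ∀ j ∈ s, i ≠ j →
      dist (ω i).2 (ω j).2 ≤ connectionThreshold lam n d (ω i).1 (ω j).1 := by
  simp only [cliqueEvent, Set.mem_ofPred_eq, SimpleGraph.isClique_iff, Set.Pairwise,
    Finset.mem_coe, girgGraph]
  exact ⟨fun h i hi j hj hij => (h hi hj hij).2, fun h i hi j hj hij => ⟨hij, h i hi j hj hij⟩⟩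

theorem cliqueEvent_mono (lam : ℝ) {n d : ℕ} {s t : Finset (Fin n)} (h : s ⊆ t) :
    cliqueEvent lam (d := d) t ⊆ cliqueEvent lam s := by
  intro ω hω
  rw [mem_cliqueEvent] at hω ⊢
  exact fun i hi j hj => hω i (h hi) j (h hj)

theorem measurable_connectionThreshold (lam : ℝ) (n d : ℕ) :
    Measurable fun p : ℝ × ℝ => connectionThreshold lam n d p.1 p.2 := by
  unfold connectionThreshold; fun_prop

/-- Clique condition on the attributes of the vertices of `s` alone. -/
def cliqueAttributes (lam : ℝ) {n : ℕ} (d : ℕ) (s : Finset (Fin n)) : Set (s → GIRGVertex d) :=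
  {a | ∀ i j, i ≠ j → dist (a i).2 (a j).2 ≤ connectionThreshold lam n d (a i).1 (a j).1}

theorem measurableSet_cliqueAttributes (lam : ℝ) {n : ℕ} (d : ℕ) (s : Finset (Fin n)) :
    MeasurableSet (cliqueAttributes lam d s) := by
  simp only [cliqueAttributes, Set.ofPred_forall]
  refine MeasurableSet.iInter fun i => MeasurableSet.iInter fun j => MeasurableSet.iInter fun _ => ?_
  exact measurableSet_le (by fun_prop)
    ((measurable_connectionThreshold lam n d).comp (f := fun a : s → GIRGVertex d =>
      ((a i).1, (a j).1)) (by fun_prop))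

theorem cliqueEvent_eq_preimage (lam : ℝ) {n d : ℕ} (s : Finset (Fin n)) :
    cliqueEvent lam (d := d) s = (fun ω (i : s) => ω i) ⁻¹' cliqueAttributes lam d s := by
  ext ω
  simp only [mem_cliqueEvent, cliqueAttributes, Set.mem_preimage, Set.mem_ofPred_eq]
  exact ⟨fun h i j hij => h i i.2 j j.2 fun h' => hij (Subtype.ext h'),
    fun h i hi j hj hij => h ⟨i, hi⟩ ⟨j, hj⟩ fun h' => hij (congrArg Subtype.val h')⟩

theorem measurableSet_cliqueEvent (lam : ℝ) {n d : ℕ} (s : Finset (Fin n)) :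
    MeasurableSet (cliqueEvent lam (d := d) s) := by
  rw [cliqueEvent_eq_preimage]
  exact measurableSet_cliqueAttributes lam d s |>.preimage (by fun_prop)

theorem isProbabilityMeasure_girgVertexLaw {β w₀ : ℝ} (hβ : 1 < β) (hw₀ : 0 < w₀) (d : ℕ) :
    IsProbabilityMeasure (girgVertexLaw β w₀ d) := by
  have := isProbabilityMeasure_paretoMeasure hw₀ (sub_pos.2 hβ)
  unfold girgVertexLaw; infer_instance

theorem isProbabilityMeasure_girgLaw {β w₀ : ℝ} (hβ : 1 < β) (hw₀ : 0 < w₀) (n d : ℕ) :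
    IsProbabilityMeasure (girgLaw n β w₀ d) := by
  have := isProbabilityMeasure_girgVertexLaw hβ hw₀ d
  unfold girgLaw; infer_instance

/-- Forget the edges between `s` and `t`; the rest depends on disjoint sets of independent
attributes. -/
theorem measure_cliqueEvent_union_le {β w₀ : ℝ} (hβ : 1 < β) (hw₀ : 0 < w₀) (lam : ℝ) {n d : ℕ}
    {s t : Finset (Fin n)} (hst : Disjoint s t) :
    girgLaw n β w₀ d (cliqueEvent lam (s ∪ t)) ≤
      girgLaw n β w₀ d (cliqueEvent lam s) * girgLaw n β w₀ d (cliqueEvent lam t) := by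
  have := isProbabilityMeasure_girgVertexLaw hβ hw₀ d
  have hind : iIndepFun (fun (i : Fin n) (ω : Fin n → GIRGVertex d) => ω i) (girgLaw n β w₀ d) :=
    iIndepFun_pi (X := fun _ => id) fun _ => aemeasurable_id
  have h := (hind.indepFun_finset s t hst fun i => measurable_pi_apply i).measure_inter_preimage_eq_mul
    _ _ (measurableSet_cliqueAttributes lam d s) (measurableSet_cliqueAttributes lam d t)
  rw [← cliqueEvent_eq_preimage, ← cliqueEvent_eq_preimage] at h
  rw [← h]
  exact measure_mono (Set.subset_inter (cliqueEvent_mono lam Finset.subset_union_left)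
    (cliqueEvent_mono lam Finset.subset_union_right))

theorem lintegral_prod_finset_pi {ι α : Type*} [Fintype ι] [MeasurableSpace α] (μ : Measure α)
    [IsProbabilityMeasure μ] (s : Finset ι) {f : α → ENNReal} (hf : Measurable f) :
    ∫⁻ w, ∏ i ∈ s, f (w i) ∂(Measure.pi fun _ : ι => μ) = (∫⁻ w, f w ∂μ) ^ s.card := by
  have hind : iIndepFun (fun (i : ι) (w : ι → α) => f (w i)) (Measure.pi fun _ : ι => μ) :=
    iIndepFun_pi (X := fun _ => f) fun _ => hf.aemeasurable
  rw [lintegral_prod_eq_prod_lintegral_of_indepFun s _ hind (by fun_prop), ← Finset.prod_const]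
  refine Finset.prod_congr rfl fun i _ => ?_
  exact (measurePreserving_eval (fun _ : ι => μ) i).lintegral_comp hf

theorem measure_cliqueEvent_le_of_card_le_five {β w₀ lam τ σ a b : ℝ} {n d : ℕ} (hβ : 1 < β)
    (hlam : 0 < lam) (hw₀ : 0 < w₀) (hn : 1 ≤ n) (hd : 1 ≤ d) (hτ0 : 0 ≤ τ)
    (hτ : -Real.log (lam * w₀ * w₀ / n) ≤ τ * d) (hσ : σ ≤ 1 - 14 * τ)
    (hb : 0 < b) (hba : b ≤ a) (hσa : σ ≤ a)
    (ha : a ≤ 2 * σ) (hab : 2 * (a - σ) ≤ b) (hab' : a ≤ 2 * b)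
    (s : Finset (Fin n)) (hs3 : 3 ≤ s.card) (hs5 : s.card ≤ 5) :
    girgLaw n β w₀ d (cliqueEvent lam s) ≤
      (∫⁻ w, ENNReal.ofReal (min ((w / √(n / lam)) ^ a) ((w / √(n / lam)) ^ b))
        ∂(paretoMeasure w₀ (β - 1))) ^ s.card := by
  have hprob := isProbabilityMeasure_paretoMeasure hw₀ (sub_pos.2 hβ)
  have hn0 : (0 : ℝ) < n := by exact_mod_cast hn
  set r := √(n / lam) with hr
  have hr0 : 0 < r := Real.sqrt_pos.2 (by positivity)
  have hr2 : r * r = n / lam := Real.mul_self_sqrt (by positivity)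
  set ν := paretoMeasure w₀ (β - 1) with hν
  have hmp := measurePreserving_arrowProdEquivProdArrow ℝ (Fin d → UnitAddCircle) (Fin n)
    (fun _ => ν) (fun _ => volume)
  set T : Set ((Fin n → ℝ) × (Fin n → Fin d → UnitAddCircle)) :=
    {p | ∀ e ∈ orderedPairs s, dist (p.2 e.1) (p.2 e.2) ≤
      connectionThreshold lam n d (p.1 e.1) (p.1 e.2)} with hT
  have hTm : MeasurableSet T := by
    simp only [hT, Set.ofPred_forall]
    refine (orderedPairs s).measurableSet_biInter fun e _ => measurableSet_le (by fun_prop) ?_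
    exact (measurable_connectionThreshold lam n d).comp
      (f := fun p : (Fin n → ℝ) × (Fin n → Fin d → UnitAddCircle) => (p.1 e.1, p.1 e.2))
      (by fun_prop)
  have hsub : cliqueEvent lam s ⊆
      (MeasurableEquiv.arrowProdEquivProdArrow ℝ (Fin d → UnitAddCircle) (Fin n)) ⁻¹' T := by
    intro ω hω e he
    rw [mem_orderedPairs] at he
    exact mem_cliqueEvent.1 hω _ he.1 _ he.2.1 he.2.2.ne
  have hae : ∀ᵐ w ∂(Measure.pi fun _ : Fin n => ν), ∀ i, w₀ ≤ w i :=
    ae_all_iff.2 fun i => (Measure.quasiMeasurePreserving_eval (fun _ : Fin n => ν) i).ae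
      (ae_le_paretoMeasure w₀ (β - 1))
  calc girgLaw n β w₀ d (cliqueEvent lam s)
      ≤ girgLaw n β w₀ d
        ((MeasurableEquiv.arrowProdEquivProdArrow ℝ (Fin d → UnitAddCircle) (Fin n)) ⁻¹' T) :=
        measure_mono hsub
    _ = ((Measure.pi fun _ : Fin n => ν).prod (Measure.pi fun _ : Fin n => volume)) T :=
        hmp.measure_preimage hTm.nullMeasurableSet
    _ = ∫⁻ w, (volume : Measure (Fin n → Fin d → UnitAddCircle)) (Prod.mk w ⁻¹' T)
          ∂(Measure.pi fun _ : Fin n => ν) := Measure.prod_apply hTm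
    _ ≤ ∫⁻ w, ∏ i ∈ s, ENNReal.ofReal (min ((w i / r) ^ a) ((w i / r) ^ b))
          ∂(Measure.pi fun _ : Fin n => ν) := by
        refine lintegral_mono_ae ?_
        filter_upwards [hae] with w hw
        have hwr : ∀ i, 0 < w i / r := fun i => div_pos (hw₀.trans_le (hw i)) hr0
        rw [← ENNReal.ofReal_prod_of_nonneg fun i _ =>
            le_min (Real.rpow_nonneg (hwr i).le _) (Real.rpow_nonneg (hwr i).le _)]
        rw [← ofReal_measureReal (measure_ne_top _ _)]
        refine ENNReal.ofReal_le_ofReal ?_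
        refine (measureReal_positions_clique_le hlam hw₀ hn hd hτ0 hτ hσ (by linarith) s hs5
          hw).trans ?_
        refine le_of_eq_of_le ?_ (prod_min_one_rpow_le hb hba hσa ha hab hab' hwr s hs3)
        refine Finset.prod_congr rfl fun e _ => ?_
        congr 2
        rw [div_mul_div_comm, hr2]
        field_simp
    _ = _ := lintegral_prod_finset_pi ν s
        (f := fun w => ENNReal.ofReal (min ((w / r) ^ a) ((w / r) ^ b))) (by fun_prop)

/-- Split off triples while more than five vertices remain; what is left always has at least three.
-/
theorem measure_cliqueEvent_le_pow {β w₀ lam : ℝ} {n d : ℕ} (hβ : 1 < β) (hw₀ : 0 < w₀)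
    {q : ENNReal}
    (hq : ∀ s : Finset (Fin n), 3 ≤ s.card → s.card ≤ 5 →
      girgLaw n β w₀ d (cliqueEvent lam s) ≤ q ^ s.card)
    (s : Finset (Fin n)) (hs : 3 ≤ s.card) :
    girgLaw n β w₀ d (cliqueEvent lam s) ≤ q ^ s.card := by
  induction s using Finset.strongInduction with
  | H s ih =>
    by_cases h5 : s.card ≤ 5
    · exact hq s hs h5
    obtain ⟨t, hts, ht⟩ := Finset.exists_subset_card_eq hs
    have hcard : (s \ t).card = s.card - 3 := by rw [Finset.card_sdiff_of_subset hts, ht]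
    have hss : s \ t ⊂ s := Finset.sdiff_ssubset hts (Finset.card_pos.1 (by omega))
    have h1 := ih (s \ t) hss (by omega)
    have h2 := hq t (by omega) (by omega)
    calc girgLaw n β w₀ d (cliqueEvent lam s)
        = girgLaw n β w₀ d (cliqueEvent lam (t ∪ s \ t)) := by
          rw [Finset.union_sdiff_of_subset hts]
      _ ≤ _ := measure_cliqueEvent_union_le hβ hw₀ lam Finset.disjoint_sdiff
      _ ≤ q ^ t.card * q ^ (s \ t).card := mul_le_mul' h2 h1
      _ = q ^ s.card := by rw [← pow_add, hcard, ht]; congr 1; omega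

/-- In dimension `d = ω(log n)` the probability that `k ≥ 3` given vertices form a clique is at most
`(C n^((1 - β) / 2))^k`. -/
theorem exists_measure_cliqueEvent_le {β w₀ lam : ℝ} (hβ2 : 2 < β) (hβ3 : β < 3) (hw₀ : 0 < w₀)
    (hlam : 0 < lam) :
    ∃ C : ℝ, 0 < C ∧ ∀ d : ℕ → ℕ, Tendsto (fun n : ℕ => (d n : ℝ) / Real.log n) atTop atTop →
      ∀ᶠ n : ℕ in atTop, ∀ s : Finset (Fin n), 3 ≤ s.card →
        girgLaw n β w₀ (d n) (cliqueEvent lam s) ≤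
          ENNReal.ofReal (C * (n : ℝ) ^ ((1 - β) / 2)) ^ s.card := by
  -- With a = β - 1 + η and b = β - 1 - η, this makes 2(a - σ) = b and 2σ - a = (3 - β)/3 > 0, while
  -- τ gives σ = 1 - 14τ.
  set η := (3 - β) / 6 with hη
  set σ := (β + 1) / 4 with hσ
  set τ := (1 - σ) / 14 with hτ
  have hη0 : 0 < η := by rw [hη]; linarith
  have hτ0 : 0 < τ := by rw [hτ, hσ]; linarith
  refine ⟨(β - 1) * w₀ ^ (β - 1) * (2 / η) * lam ^ ((β - 1) / 2), ?_, fun d hd => ?_⟩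
  · have : 0 < β - 1 := by linarith
    positivity
  set A := |Real.log (lam * w₀ * w₀)| + 1 with hA
  have hlog := Real.tendsto_log_atTop.comp tendsto_natCast_atTop_atTop
  -- The factor 2 pays for log n once and for the constant |log(λw₀²)| ≤ log n once.
  filter_upwards [hd.eventually_ge_atTop (2 / τ), hlog.eventually_ge_atTop A,
    eventually_ge_atTop 1] with n hn1 hn2 hn
  simp only [Function.comp_apply] at hn2
  have hA0 : 0 < A := by positivity
  have hlogn : 0 < Real.log n := hA0.trans_le hn2
  have hn0 : (0 : ℝ) < n := by exact_mod_cast hn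
  have hdn : 2 * Real.log n ≤ τ * d n := by
    rw [le_div_iff₀ hlogn, div_mul_eq_mul_div, div_le_iff₀ hτ0] at hn1
    linarith
  have hd1 : 1 ≤ d n := by
    rw [Nat.one_le_iff_ne_zero]
    intro h0
    rw [h0] at hdn
    simp only [Nat.cast_zero, mul_zero] at hdn
    linarith
  have hτd : -Real.log (lam * w₀ * w₀ / n) ≤ τ * d n := by
    rw [Real.log_div (by positivity) hn0.ne']
    have := neg_abs_le (Real.log (lam * w₀ * w₀))
    linarith
  refine measure_cliqueEvent_le_pow (by linarith) hw₀ fun s hs3 hs5 => ?_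
  refine (measure_cliqueEvent_le_of_card_le_five (a := β - 1 + η) (b := β - 1 - η) (σ := σ) (τ := τ)
    (by linarith) hlam hw₀ hn hd1 hτ0.le hτd (by linarith) (by linarith) (by linarith) (by linarith)
    (by linarith) (by linarith) (by linarith) s hs3 hs5).trans ?_
  refine pow_le_pow_left' ((lintegral_min_rpow_paretoMeasure_le hw₀ (by linarith) hη0
    (Real.sqrt_pos.2 (by positivity))).trans_eq ?_) _
  congr 1
  rw [mul_assoc _ (lam ^ _)]
  congr 1
  rw [Real.sqrt_eq_rpow, ← Real.rpow_mul (by positivity), Real.div_rpow hn0.le hlam.le,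
    div_eq_mul_inv, ← Real.rpow_neg hlam.le, mul_comm]
  congr 2 <;> ring

/-! ### Heavy vertices -/

theorem paretoMeasure_Ici {t γ r : ℝ} (ht : 0 < t) (hγ : 0 < γ) (hr : t ≤ r) :
    paretoMeasure t γ (Set.Ici r) = ENNReal.ofReal (t ^ γ * r ^ (-γ)) := by
  have hr0 := ht.trans_le hr
  rw [paretoMeasure, withDensity_apply _ measurableSet_Ici,
    setLIntegral_congr_fun (g := fun x => ENNReal.ofReal (γ * t ^ γ * x ^ (-(γ + 1))))
      measurableSet_Ici fun x hx => paretoPDF_of_le (hr.trans hx),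
    setLIntegral_congr Ioi_ae_eq_Ici.symm]
  have hint : IntegrableOn (fun w : ℝ => w ^ (-(γ + 1))) (Set.Ioi r) volume :=
    integrableOn_Ioi_rpow_of_lt (by linarith) hr0
  rw [← ofReal_integral_eq_lintegral_ofReal (hint.const_mul _), integral_const_mul,
    integral_Ioi_rpow_of_lt (by linarith) hr0]
  · congr 1
    rw [show -(γ + 1) + 1 = -γ by ring]
    field_simp
  · filter_upwards [ae_restrict_mem measurableSet_Ioi] with w hw
    have : 0 < w := hr0.trans hw
    simp only [Pi.zero_apply]; positivity

theorem girgVertexLaw_heavy {β w₀ lam : ℝ} {n : ℕ} (hβ : 1 < β) (hw₀ : 0 < w₀) (hlam : 0 < lam)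
    (hn : w₀ ≤ √(n / lam)) (d : ℕ) :
    girgVertexLaw β w₀ d {v | √(n / lam) ≤ v.1} =
      ENNReal.ofReal (w₀ ^ (β - 1) * lam ^ ((β - 1) / 2) * (n : ℝ) ^ ((1 - β) / 2)) := by
  have hprob := isProbabilityMeasure_paretoMeasure hw₀ (sub_pos.2 hβ)
  have : {v : GIRGVertex d | √(n / lam) ≤ v.1} = Set.Ici √(n / lam) ×ˢ Set.univ := by
    ext v; simp
  rw [this, girgVertexLaw, Measure.prod_prod, measure_univ, mul_one,
    paretoMeasure_Ici hw₀ (sub_pos.2 hβ) hn, mul_assoc]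
  congr 2
  have hn0 : (0 : ℝ) ≤ n := Nat.cast_nonneg n
  rw [Real.sqrt_eq_rpow, ← Real.rpow_mul (by positivity), Real.div_rpow hn0 hlam.le,
    div_eq_mul_inv, ← Real.rpow_neg hlam.le, mul_comm]
  congr 2 <;> ring

theorem dist_torus_le_half {d : ℕ} (x y : Fin d → UnitAddCircle) : dist x y ≤ 1 / 2 := by
  refine (dist_pi_le_iff (by norm_num)).2 fun i => ?_
  rw [dist_eq_norm]
  simpa using AddCircle.norm_le_half_period 1 one_ne_zero (x := x i - y i)

/-- For two such weights the threshold is at least 1/2, which bounds every distance on the torus. -/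
theorem mem_cliqueEvent_of_heavy {lam : ℝ} {n d : ℕ} (hlam : 0 < lam) (hn : 1 ≤ n)
    {s : Finset (Fin n)} {ω : Fin n → GIRGVertex d} (h : ∀ i ∈ s, √(n / lam) ≤ (ω i).1) :
    ω ∈ cliqueEvent lam s := by
  have hn0 : (0 : ℝ) < n := by exact_mod_cast hn
  refine mem_cliqueEvent.2 fun i hi j hj _ => (dist_torus_le_half _ _).trans ?_
  have h1 : n / lam ≤ (ω i).1 * (ω j).1 := by
    rw [← Real.mul_self_sqrt (by positivity : 0 ≤ n / lam)]
    exact mul_le_mul (h i hi) (h j hj) (Real.sqrt_nonneg _) ((Real.sqrt_nonneg _).trans (h i hi))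
  have h2 : 1 ≤ lam * (ω i).1 * (ω j).1 / n := by
    rw [le_div_iff₀ hn0, one_mul, mul_assoc, mul_comm]
    exact (div_le_iff₀ hlam).1 h1
  have := Real.one_le_rpow h2 (by positivity : 0 ≤ 1 / (d : ℝ))
  rw [connectionThreshold]; linarith

theorem measurableSet_heavy (r : ℝ) (d : ℕ) : MeasurableSet {v : GIRGVertex d | r ≤ v.1} :=
  measurableSet_le measurable_const measurable_fst

theorem pow_le_measure_cliqueEvent {β w₀ lam : ℝ} {n d : ℕ} (hβ : 1 < β) (hw₀ : 0 < w₀)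
    (hlam : 0 < lam) (hn : 1 ≤ n) (s : Finset (Fin n)) :
    girgVertexLaw β w₀ d {v | √(n / lam) ≤ v.1} ^ s.card ≤ girgLaw n β w₀ d (cliqueEvent lam s) := by
  have := isProbabilityMeasure_girgVertexLaw hβ hw₀ d
  set A : Set (GIRGVertex d) := {v | √(n / lam) ≤ v.1}
  have hA : MeasurableSet A := measurableSet_heavy √(n / lam) d
  rw [← lintegral_indicator_one hA, ← lintegral_prod_finset_pi _ s (measurable_one.indicator hA),
    ← lintegral_indicator_one (measurableSet_cliqueEvent lam s)]
  refine lintegral_mono fun ω => ?_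
  by_cases h : ∀ i ∈ s, √(n / lam) ≤ (ω i).1
  · rw [Set.indicator_of_mem (mem_cliqueEvent_of_heavy hlam hn h)]
    exact Finset.prod_le_one' fun i hi => by
      rw [Set.indicator_of_mem (show ω i ∈ A from h i hi)]; rfl
  · push Not at h
    obtain ⟨i, hi, hlt⟩ := h
    have h0 : A.indicator (1 : GIRGVertex d → ENNReal) (ω i) = 0 :=
      Set.indicator_of_notMem (show ω i ∉ A from not_le.2 hlt) _
    rw [Finset.prod_eq_zero hi h0]
    exact zero_le

/-! ### Expected number of cliques -/

theorem expectedCliques_eq_sum {β w₀ : ℝ} (hβ : 1 < β) (hw₀ : 0 < w₀) (lam : ℝ) (n d k : ℕ) :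
    expectedCliques lam β w₀ n d k =
      ∑ s ∈ Finset.powersetCard k (Finset.univ : Finset (Fin n)),
        (girgLaw n β w₀ d).real (cliqueEvent lam s) := by
  classical
  have := isProbabilityMeasure_girgLaw hβ hw₀ n d
  have h : ∀ ω : Fin n → GIRGVertex d, (numCliques (girgGraph lam ω) k : ℝ) =
      ∑ s ∈ Finset.powersetCard k (Finset.univ : Finset (Fin n)),
        (cliqueEvent lam s).indicator (fun _ => (1 : ℝ)) ω := by
    intro ω
    have hset : {s : Finset (Fin n) | (girgGraph lam ω).IsNClique k s} =
        ((Finset.powersetCard k (Finset.univ : Finset (Fin n))).filter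
          fun s => ω ∈ cliqueEvent lam s : Finset (Finset (Fin n))) := by
      ext s
      rw [Finset.coe_filter, Set.mem_ofPred_eq, Set.mem_ofPred_eq, SimpleGraph.isNClique_iff,
        Finset.mem_powersetCard_univ, and_comm]
      rfl
    rw [numCliques, hset, Set.ncard_coe_finset]
    simp [Set.indicator_apply]
  simp only [expectedCliques, h]
  rw [integral_finsetSum _ fun s _ =>
    (integrable_const 1).indicator (measurableSet_cliqueEvent lam s)]
  refine Finset.sum_congr rfl fun s _ => ?_
  rw [integral_indicator (measurableSet_cliqueEvent lam s)]
  simp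

theorem div_pow_le_choose {n k : ℕ} (hkn : k ≤ n) : ((n : ℝ) / k) ^ k ≤ n.choose k := by
  induction k generalizing n with
  | zero => simp
  | succ k ih =>
    obtain ⟨m, rfl⟩ : ∃ m, n = m + 1 := ⟨n - 1, by omega⟩
    have hkm : k ≤ m := by omega
    have hk0 : (0 : ℝ) < (k + 1 : ℕ) := by positivity
    have h1 : ((m + 1).choose (k + 1) : ℝ) = ((m + 1 : ℕ) : ℝ) / ((k + 1 : ℕ) : ℝ) * m.choose k := by
      rw [div_mul_eq_mul_div, eq_div_iff hk0.ne']
      exact_mod_cast (Nat.add_one_mul_choose_eq m k).symm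
    rw [h1, pow_succ']
    refine mul_le_mul_of_nonneg_left (le_trans ?_ (ih hkm)) (by positivity)
    rcases Nat.eq_zero_or_pos k with rfl | hk
    · simp
    · refine pow_le_pow_left₀ (by positivity) ?_ k
      have hk' : (0 : ℝ) < k := by exact_mod_cast hk
      have hkm' : (k : ℝ) ≤ m := by exact_mod_cast hkm
      rw [div_le_div_iff₀ hk0 hk']
      push_cast
      nlinarith

theorem choose_le_exp_mul_div_pow (n : ℕ) {k : ℕ} (hk : 1 ≤ k) :
    (n.choose k : ℝ) ≤ (Real.exp 1 * n / k) ^ k := by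
  have hk0 : (0 : ℝ) < k := by exact_mod_cast hk
  have h1 := Nat.choose_le_pow_div (α := ℝ) k n
  have h2 := Real.pow_div_factorial_le_exp _ hk0.le k
  refine h1.trans ?_
  rw [div_pow, mul_pow, ← Real.exp_nat_mul, mul_one, div_le_div_iff₀ (by positivity) (by positivity)]
  rw [div_le_iff₀ (by positivity)] at h2
  have : (0 : ℝ) ≤ (n : ℝ) ^ k := by positivity
  nlinarith

theorem sum_measure_cliqueEvent_le {β w₀ lam C : ℝ} {n d k : ℕ} (hC : 0 < C) (hn : 1 ≤ n)
    (hq : ∀ s : Finset (Fin n), 3 ≤ s.card → girgLaw n β w₀ d (cliqueEvent lam s) ≤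
      ENNReal.ofReal (C * (n : ℝ) ^ ((1 - β) / 2)) ^ s.card) (hk : 3 ≤ k) :
    ∑ s ∈ Finset.powersetCard k (Finset.univ : Finset (Fin n)),
        girgLaw n β w₀ d (cliqueEvent lam s) ≤
      ENNReal.ofReal (((n : ℝ) ^ ((3 - β) / 2) / ((Real.exp 1 * C)⁻¹ * k)) ^ k) := by
  have hn0 : (0 : ℝ) < n := by exact_mod_cast hn
  have hk0 : (0 : ℝ) < k := by exact_mod_cast (by omega : 0 < k)
  calc ∑ s ∈ Finset.powersetCard k (Finset.univ : Finset (Fin n)),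
        girgLaw n β w₀ d (cliqueEvent lam s)
      ≤ ∑ s ∈ Finset.powersetCard k (Finset.univ : Finset (Fin n)),
        ENNReal.ofReal ((C * (n : ℝ) ^ ((1 - β) / 2)) ^ k) := by
        refine Finset.sum_le_sum fun s hs => ?_
        have hsk := (Finset.mem_powersetCard.1 hs).2
        rw [ENNReal.ofReal_pow (by positivity), ← hsk]
        exact hq s (by omega)
    _ = ENNReal.ofReal (n.choose k * (C * (n : ℝ) ^ ((1 - β) / 2)) ^ k) := by
        rw [Finset.sum_const, Finset.card_powersetCard, Finset.card_univ, Fintype.card_fin,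
          nsmul_eq_mul, ENNReal.ofReal_mul (by positivity), ENNReal.ofReal_natCast]
    _ ≤ _ := by
        refine ENNReal.ofReal_le_ofReal ?_
        calc (n.choose k : ℝ) * (C * (n : ℝ) ^ ((1 - β) / 2)) ^ k
            ≤ (Real.exp 1 * n / k) ^ k * (C * (n : ℝ) ^ ((1 - β) / 2)) ^ k := by
              gcongr; exact choose_le_exp_mul_div_pow n (by omega)
          _ = _ := by
              rw [← mul_pow]
              congr 1
              have : (n : ℝ) ^ ((3 - β) / 2) = n * (n : ℝ) ^ ((1 - β) / 2) := by
                nth_rewrite 2 [← Real.rpow_one (n : ℝ)]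
                rw [← Real.rpow_add hn0]; congr 1; ring
              rw [this]
              field_simp

theorem rpow_mul_zpow_neg_eq {x c β : ℝ} (hx : 0 ≤ x) (k : ℕ) :
    x ^ ((k : ℝ) / 2 * (3 - β)) * (c * k) ^ (-(k : ℤ)) = (x ^ ((3 - β) / 2) / (c * k)) ^ k := by
  rw [div_pow, ← Real.rpow_natCast (x ^ _), ← Real.rpow_mul hx, zpow_neg, zpow_natCast,
    div_eq_mul_inv]
  congr 2; ring

theorem le_expectedCliques {β w₀ lam : ℝ} {n d k : ℕ} (hβ : 1 < β) (hw₀ : 0 < w₀) (hlam : 0 < lam)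
    (hn : 1 ≤ n) (hnr : w₀ ≤ √(n / lam)) (hkn : k ≤ n) :
    ((n : ℝ) ^ ((3 - β) / 2) / ((w₀ ^ (β - 1) * lam ^ ((β - 1) / 2))⁻¹ * k)) ^ k ≤
      expectedCliques lam β w₀ n d k := by
  have := isProbabilityMeasure_girgLaw hβ hw₀ n d
  have hn0 : (0 : ℝ) < n := by exact_mod_cast hn
  set c := w₀ ^ (β - 1) * lam ^ ((β - 1) / 2) with hc
  have hc0 : 0 < c := by positivity
  rw [expectedCliques_eq_sum hβ hw₀]
  calc ((n : ℝ) ^ ((3 - β) / 2) / (c⁻¹ * k)) ^ k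
      = ((n : ℝ) / k) ^ k * (c * (n : ℝ) ^ ((1 - β) / 2)) ^ k := by
        rw [← mul_pow]
        congr 1
        have : (n : ℝ) ^ ((3 - β) / 2) = n * (n : ℝ) ^ ((1 - β) / 2) := by
          nth_rewrite 2 [← Real.rpow_one (n : ℝ)]
          rw [← Real.rpow_add hn0]; congr 1; ring
        rw [this]
        field_simp
    _ ≤ n.choose k * (c * (n : ℝ) ^ ((1 - β) / 2)) ^ k := by
        gcongr; exact div_pow_le_choose hkn
    _ = ∑ s ∈ Finset.powersetCard k (Finset.univ : Finset (Fin n)),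
          (c * (n : ℝ) ^ ((1 - β) / 2)) ^ k := by
        rw [Finset.sum_const, Finset.card_powersetCard, Finset.card_univ, Fintype.card_fin,
          nsmul_eq_mul]
    _ ≤ _ := by
        refine Finset.sum_le_sum fun s hs => ?_
        have h := pow_le_measure_cliqueEvent (d := d) hβ hw₀ hlam hn s
        rw [girgVertexLaw_heavy hβ hw₀ hlam hnr, (Finset.mem_powersetCard.1 hs).2,
          ← ENNReal.ofReal_pow (by positivity)] at h
        exact (ENNReal.ofReal_le_iff_le_toReal (measure_ne_top _ _)).1 h

/-! ### Clique number -/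

/-- Chernoff bound for the number X of heavy vertices, which form a clique: the threshold m is a
quarter of E[X] = np. -/
theorem measure_cliqueNum_lt_le {β w₀ lam : ℝ} {n d : ℕ} (hβ : 1 < β) (hw₀ : 0 < w₀)
    (hlam : 0 < lam) (hn : 1 ≤ n) (hnr : w₀ ≤ √(n / lam)) :
    girgLaw n β w₀ d {ω | ((girgGraph lam ω).cliqueNum : ℝ) <
        w₀ ^ (β - 1) * lam ^ ((β - 1) / 2) / 4 * (n : ℝ) ^ ((3 - β) / 2)} ≤
      ENNReal.ofReal (Real.exp
        (-(w₀ ^ (β - 1) * lam ^ ((β - 1) / 2) / 4 * (n : ℝ) ^ ((3 - β) / 2)))) := by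
  classical
  have := isProbabilityMeasure_girgVertexLaw hβ hw₀ d
  have := isProbabilityMeasure_girgLaw hβ hw₀ n d
  have hn0 : (0 : ℝ) < n := by exact_mod_cast hn
  set p := w₀ ^ (β - 1) * lam ^ ((β - 1) / 2) * (n : ℝ) ^ ((1 - β) / 2) with hp
  have hp0 : 0 < p := by positivity
  set m := w₀ ^ (β - 1) * lam ^ ((β - 1) / 2) / 4 * (n : ℝ) ^ ((3 - β) / 2) with hm
  have hmp : m = n * p / 4 := by
    have : (n : ℝ) ^ ((3 - β) / 2) = n * (n : ℝ) ^ ((1 - β) / 2) := by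
      nth_rewrite 2 [← Real.rpow_one (n : ℝ)]
      rw [← Real.rpow_add hn0]; congr 1; ring
    rw [hm, hp, this]; ring
  set A : Set (GIRGVertex d) := {v | √(n / lam) ≤ v.1} with hA
  have hAm : MeasurableSet A := measurableSet_heavy √(n / lam) d
  have hpA : girgVertexLaw β w₀ d A = ENNReal.ofReal p := girgVertexLaw_heavy hβ hw₀ hlam hnr d
  have hp1 : p ≤ 1 := by
    have h := prob_le_one (μ := girgVertexLaw β w₀ d) (s := A)
    rwa [hpA, ENNReal.ofReal_le_one] at h
  set g : GIRGVertex d → ENNReal := fun v => ENNReal.ofReal (Real.exp (-A.indicator 1 v)) with hg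
  have hgm : Measurable g := by
    have : Measurable (A.indicator (1 : GIRGVertex d → ℝ)) := measurable_one.indicator hAm
    fun_prop
  have hgint : ∫⁻ v, g v ∂(girgVertexLaw β w₀ d) ≤ ENNReal.ofReal (Real.exp (-(p / 2))) := by
    rw [← lintegral_add_compl _ hAm,
      setLIntegral_congr_fun (g := fun _ => ENNReal.ofReal (Real.exp (-1))) hAm
        (fun v hv => by simp [hg, Set.indicator_of_mem hv]),
      setLIntegral_congr_fun (g := fun _ => 1) hAm.compl
        (fun v hv => by simp [hg, Set.indicator_of_notMem hv]),
      setLIntegral_const, setLIntegral_const, prob_compl_eq_one_sub hAm, hpA, one_mul,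
      ← ENNReal.ofReal_one, ← ENNReal.ofReal_sub _ hp0.le, ← ENNReal.ofReal_mul (Real.exp_pos _).le,
      ← ENNReal.ofReal_add (by positivity) (by linarith)]
    refine ENNReal.ofReal_le_ofReal ?_
    have h1 := Real.add_one_le_exp (-(p / 2))
    have h2 : Real.exp (-1) ≤ 1 / 2 := by
      rw [Real.exp_neg, one_div]
      exact inv_anti₀ two_pos (by linarith [Real.add_one_le_exp 1])
    nlinarith
  have hprod : ∀ ω : Fin n → GIRGVertex d, ∏ i, g (ω i) = ENNReal.ofReal
      (Real.exp (-((Finset.univ.filter fun i => ω i ∈ A).card : ℝ))) := by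
    intro ω
    simp only [hg]
    rw [← ENNReal.ofReal_prod_of_nonneg fun _ _ => (Real.exp_pos _).le, ← Real.exp_sum,
      Finset.sum_neg_distrib]
    congr 3
    simp [Set.indicator_apply]
  have hmarkov := mul_meas_ge_le_lintegral (μ := girgLaw n β w₀ d)
    (f := fun ω => ∏ i, g (ω i)) (by fun_prop) (ENNReal.ofReal (Real.exp (-m)))
  -- E[exp(-X)] ≤ exp(-np/2) = exp(-2m); Markov at level exp(-m) leaves exp(-m).
  have hint : ∫⁻ ω, ∏ i, g (ω i) ∂(girgLaw n β w₀ d) ≤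
      ENNReal.ofReal (Real.exp (-m)) * ENNReal.ofReal (Real.exp (-m)) := by
    rw [girgLaw, lintegral_prod_finset_pi _ _ hgm]
    refine (pow_le_pow_left' hgint _).trans_eq ?_
    rw [← ENNReal.ofReal_pow (Real.exp_pos _).le, ← Real.exp_nat_mul,
      ← ENNReal.ofReal_mul (Real.exp_pos _).le, ← Real.exp_add, hmp, Finset.card_univ,
      Fintype.card_fin]
    congr 2; ring
  have hcancel := (ENNReal.mul_le_mul_iff_right (by simp [Real.exp_pos]) ENNReal.ofReal_ne_top).1
    (hmarkov.trans hint)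
  refine (measure_mono fun ω hω => ?_).trans hcancel
  simp only [Set.mem_ofPred_eq] at hω ⊢
  rw [hprod]
  refine ENNReal.ofReal_le_ofReal (Real.exp_le_exp.2 (neg_le_neg ?_))
  have hcl : ω ∈ cliqueEvent lam (Finset.univ.filter fun i => ω i ∈ A) :=
    mem_cliqueEvent_of_heavy hlam hn fun i hi => (Finset.mem_filter.1 hi).2
  have hle := SimpleGraph.IsClique.card_le_cliqueNum (G := girgGraph lam ω) (tc := hcl)
  have : ((Finset.univ.filter fun i => ω i ∈ A).card : ℝ) ≤ (girgGraph lam ω).cliqueNum := by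
    exact_mod_cast hle
  linarith

theorem measure_le_cliqueNum_le {β w₀ lam : ℝ} {n d k : ℕ} :
    girgLaw n β w₀ d {ω | k ≤ (girgGraph lam ω).cliqueNum} ≤
      ∑ s ∈ Finset.powersetCard k (Finset.univ : Finset (Fin n)),
        girgLaw n β w₀ d (cliqueEvent lam s) := by
  refine (measure_mono fun ω hω => ?_).trans (measure_biUnion_finset_le _ _)
  obtain ⟨s, hs⟩ := (girgGraph lam ω).exists_isNClique_cliqueNum
  obtain ⟨t, hts, ht⟩ := Finset.exists_subset_card_eq (hω.trans_eq hs.card_eq.symm)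
  refine Set.mem_biUnion (x := t) (by simp [Finset.mem_powersetCard, ht]) ?_
  exact cliqueEvent_mono lam hts hs.isClique

/-! ### Assembly -/

theorem mainTheorem5 (β w₀ lam : ℝ) (hβ2 : 2 < β) (hβ3 : β < 3) (hw₀ : 0 < w₀) (hlam : 0 < lam) :
    (∃ c₁ c₂ : ℝ, 0 < c₁ ∧ 0 < c₂ ∧
      ∀ d : ℕ → ℕ, Tendsto (fun n : ℕ => (d n : ℝ) / Real.log n) atTop atTop →
        ∀ᶠ n : ℕ in atTop, ∀ k : ℕ, 3 ≤ k → k ≤ n →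
          (n : ℝ) ^ ((k : ℝ) / 2 * (3 - β)) * (c₁ * k) ^ (-(k : ℤ))
              ≤ expectedCliques lam β w₀ n (d n) k ∧
          expectedCliques lam β w₀ n (d n) k
              ≤ (n : ℝ) ^ ((k : ℝ) / 2 * (3 - β)) * (c₂ * k) ^ (-(k : ℤ))) ∧
    (∃ C₁ C₂ : ℝ, 0 < C₁ ∧ 0 < C₂ ∧
      ∀ d : ℕ → ℕ, Tendsto (fun n : ℕ => (d n : ℝ) / Real.log n) atTop atTop →
        Tendsto (fun n : ℕ => girgLaw n β w₀ (d n)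
            {ω | C₁ * (n : ℝ) ^ ((3 - β) / 2) ≤ ((girgGraph lam ω).cliqueNum : ℝ) ∧
              ((girgGraph lam ω).cliqueNum : ℝ) ≤ C₂ * (n : ℝ) ^ ((3 - β) / 2)})
          atTop (𝓝 1)) := by
  have hβ : 1 < β := by linarith
  obtain ⟨C, hC, hclique⟩ := exists_measure_cliqueEvent_le hβ2 hβ3 hw₀ hlam
  set c := w₀ ^ (β - 1) * lam ^ ((β - 1) / 2) with hc
  have hc0 : 0 < c := by positivity
  set c₂ := (Real.exp 1 * C)⁻¹ with hc₂
  have hc₂0 : 0 < c₂ := by positivity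
  have hheavy : ∀ᶠ n : ℕ in atTop, w₀ ≤ √((n : ℝ) / lam) := by
    filter_upwards [tendsto_natCast_atTop_atTop.eventually_ge_atTop (w₀ ^ 2 * lam)] with n hn
    exact Real.le_sqrt_of_sq_le ((le_div_iff₀ hlam).2 hn)
  have hx : Tendsto (fun n : ℕ => (n : ℝ) ^ ((3 - β) / 2)) atTop atTop :=
    (tendsto_rpow_atTop (by linarith)).comp tendsto_natCast_atTop_atTop
  -- The 2 in 2 / c₂ makes the base of the first-moment bound at most 1/2 beyond the threshold, so
  -- that bound is at most 2^(-k).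
  refine ⟨⟨c⁻¹, c₂, inv_pos.2 hc0, hc₂0, fun d hd => ?_⟩,
    ⟨c / 4, 2 / c₂, by positivity, by positivity, fun d hd => ?_⟩⟩
  · filter_upwards [hclique d hd, hheavy, eventually_ge_atTop 1] with n hn hnr hn1 k hk hkn
    have := isProbabilityMeasure_girgLaw hβ hw₀ n (d n)
    rw [rpow_mul_zpow_neg_eq (Nat.cast_nonneg n), rpow_mul_zpow_neg_eq (Nat.cast_nonneg n)]
    refine ⟨le_expectedCliques hβ hw₀ hlam hn1 hnr hkn, ?_⟩
    have h := sum_measure_cliqueEvent_le hC hn1 hn hk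
    rw [expectedCliques_eq_sum hβ hw₀]
    simp only [measureReal_def]
    rw [← ENNReal.toReal_sum fun s _ => measure_ne_top _ _]
    exact ENNReal.toReal_le_of_le_ofReal (by positivity) h
  · set k : ℕ → ℕ := fun n => ⌊2 / c₂ * (n : ℝ) ^ ((3 - β) / 2)⌋₊ + 1 with hk
    have hkt : Tendsto k atTop atTop :=
      (tendsto_add_atTop_nat 1).comp
        (tendsto_nat_floor_atTop.comp (hx.const_mul_atTop (by positivity : 0 < 2 / c₂)))
    have herr : Tendsto (fun n : ℕ => 1 - (ENNReal.ofReal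
        (Real.exp (-(c / 4 * (n : ℝ) ^ ((3 - β) / 2)))) + ENNReal.ofReal ((1 / 2) ^ k n)))
        atTop (𝓝 1) := by
      have h1 : Tendsto (fun n : ℕ => ENNReal.ofReal
          (Real.exp (-(c / 4 * (n : ℝ) ^ ((3 - β) / 2))))) atTop (𝓝 0) := by
        rw [← ENNReal.ofReal_zero]
        exact ENNReal.tendsto_ofReal (Real.tendsto_exp_neg_atTop_nhds_zero.comp
          (hx.const_mul_atTop (by positivity)))
      have h2 : Tendsto (fun n : ℕ => ENNReal.ofReal ((1 / 2) ^ k n)) atTop (𝓝 0) := by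
        rw [← ENNReal.ofReal_zero]
        exact ENNReal.tendsto_ofReal
          ((tendsto_pow_atTop_nhds_zero_of_lt_one (by norm_num) (by norm_num)).comp hkt)
      simpa using ENNReal.Tendsto.sub tendsto_const_nhds (h1.add h2) (Or.inl ENNReal.one_ne_top)
    refine tendsto_of_tendsto_of_tendsto_of_le_of_le' herr tendsto_const_nhds ?_ ?_
    · filter_upwards [hclique d hd, hheavy, eventually_ge_atTop 1, hkt.eventually_ge_atTop 3]
        with n hn hnr hn1 hk3
      have := isProbabilityMeasure_girgLaw hβ hw₀ n (d n)
      have hlow := measure_cliqueNum_lt_le (d := d n) hβ hw₀ hlam hn1 hnr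
      have hk0 : 2 / c₂ * (n : ℝ) ^ ((3 - β) / 2) < k n := by
        simp only [hk]; exact_mod_cast Nat.lt_floor_add_one _
      have hup : girgLaw n β w₀ (d n) {ω | k n ≤ (girgGraph lam ω).cliqueNum} ≤
          ENNReal.ofReal ((1 / 2) ^ k n) := by
        refine measure_le_cliqueNum_le.trans ((sum_measure_cliqueEvent_le hC hn1 hn hk3).trans ?_)
        refine ENNReal.ofReal_le_ofReal (pow_le_pow_left₀ (by positivity) ?_ _)
        have hkpos : (0 : ℝ) < k n := by exact_mod_cast (by omega : 0 < k n)
        rw [div_le_iff₀ (by positivity)]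
        rw [div_mul_eq_mul_div, div_lt_iff₀ hc₂0] at hk0
        linarith
      rw [tsub_le_iff_right]
      -- Covering the whole space uses only subadditivity, so the clique-number events need not be
      -- shown measurable.
      calc (1 : ENNReal) = girgLaw n β w₀ (d n) Set.univ := measure_univ.symm
        _ ≤ girgLaw n β w₀ (d n) (_ ∪ ({ω | ((girgGraph lam ω).cliqueNum : ℝ) <
              c / 4 * (n : ℝ) ^ ((3 - β) / 2)} ∪ {ω | k n ≤ (girgGraph lam ω).cliqueNum})) := by
            refine measure_mono fun ω _ => ?_
            by_cases h1 : c / 4 * (n : ℝ) ^ ((3 - β) / 2) ≤ ((girgGraph lam ω).cliqueNum : ℝ)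
            · by_cases h2 : ((girgGraph lam ω).cliqueNum : ℝ) ≤ 2 / c₂ * (n : ℝ) ^ ((3 - β) / 2)
              · exact Or.inl ⟨h1, h2⟩
              · exact Or.inr (Or.inr (Nat.floor_lt (by positivity) |>.2 (not_le.1 h2)))
            · exact Or.inr (Or.inl (not_le.1 h1))
        _ ≤ _ := (measure_union_le _ _).trans (add_le_add_right (measure_union_le _ _) _)
        _ ≤ _ := add_le_add_right (add_le_add hlow hup) _
    · exact Eventually.of_forall fun n => by
        have := isProbabilityMeasure_girgLaw hβ hw₀ n (d n)
        exact prob_le_one
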